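/- Let $H^2(\mathbb D^2)$ be the Hardy space over the bidisk, let $M=[(z-w)^2]$ be the submodule generated by $(z-w)^2$, i.e. the smallest closed subspace of $H^2(\mathbb D^2)$ that contains $(z-w)^2$ and is invariant under multiplication by $z$ and by $w$, and let $K^M(\lambda,\cdot)$ be the reproducing kernel of $M$. Let $C$ be the core operator of $M$, that is, the bounded operator on $H^2(\mathbb D^2)$ given by \[ (Cf)(z_1,z_2)=\int_{\mathbb T^2} (1-\overline{\lambda_1}z_1)(1-\overline{\lambda_2}z_2)\,K^M(\lambda,z)\,f(\lambda)\,dm(\lambda),\qquad z=(z_1,z_2)\in\mathbb D^2, \] where $m$ is the normalized Lebesgue measure on $\mathbb T^2$ and boundary values are taken in $\lambda$. Then the set of eigenvalues of $C$ is exactly \[ \{0,\,1\}\cup\Big\{\pm\frac{2}{n+2} : n\ge 1\Big\}. \] In particular, the largest eigenvalue of $C$ is $1$, it is simple, and the second largest eigenvalue of $C$ is $\frac23$. -/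

import Mathlib

open MeasureTheory ComplexConjugate
open scoped ENNReal InnerProductSpace

noncomputable section

namespace HardyBidisk

/-! ## The torus, the bidisk and the Hardy space -/

/-- The two-torus, parametrised additively: `t` stands for the point
`(exp (2πi t₀), exp (2πi t₁))` of the distinguished boundary of the bidisk. -/
abbrev Torus : Type := UnitAddTorus (Fin 2)

/-- The normalised Lebesgue measure on the two-torus. -/
abbrev torusMeasure : Measure Torus :=
  Measure.pi fun _ : Fin 2 => (AddCircle.haarAddCircle : Measure UnitAddCircle)

/-- The open unit bidisk. -/
abbrev Bidisk : Type := {z : Fin 2 → ℂ // ∀ i, ‖z i‖ < 1}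

/-- The `i`-th coordinate function on the torus, `t ↦ exp (2πi tᵢ)`. -/
def coord (i : Fin 2) : C(Torus, ℂ) where
  toFun t := fourier 1 (t i)
  continuous_toFun := by fun_prop

/-- `L²` of the torus with respect to normalised Lebesgue measure. -/
abbrev L2Torus : Type := Lp ℂ 2 torusMeasure

lemma mFourierBasis_repr' (f : L2Torus) (n : Fin 2 → ℤ) :
    (UnitAddTorus.mFourierBasis (d := Fin 2)).repr f n = UnitAddTorus.mFourierCoeff f n :=
  UnitAddTorus.mFourierBasis_repr f n

lemma mFourierCoeff_eq_inner (f : L2Torus) (n : Fin 2 → ℤ) :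
    UnitAddTorus.mFourierCoeff f n
      = ⟪(UnitAddTorus.mFourierLp 2 n : L2Torus), f⟫_ℂ := by
  rw [← mFourierBasis_repr', HilbertBasis.repr_apply_apply, UnitAddTorus.coe_mFourierBasis]

/-- The Hardy space of the bidisk, realised by boundary values: the functions in `L²` of the torus
all of whose Fourier coefficients with some negative index vanish. -/
def hardySpace : Submodule ℂ L2Torus where
  carrier := {f | ∀ n : Fin 2 → ℤ, (∃ i, n i < 0) → UnitAddTorus.mFourierCoeff f n = 0}
  zero_mem' := by
    intro n _
    rw [mFourierCoeff_eq_inner, inner_zero_right]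
  add_mem' := by
    intro f g hf hg n hn
    have hf' := hf n hn
    have hg' := hg n hn
    rw [mFourierCoeff_eq_inner] at hf' hg' ⊢
    rw [inner_add_right, hf', hg', add_zero]
  smul_mem' := by
    intro c f hf n hn
    have hf' := hf n hn
    rw [mFourierCoeff_eq_inner] at hf' ⊢
    rw [inner_smul_right, hf', mul_zero]

/-- The Hilbert space `H²` of the bidisk. -/
abbrev H2 : Type := hardySpace

lemma isClosed_hardySpace : IsClosed (hardySpace : Set L2Torus) := by
  have h : (hardySpace : Set L2Torus) = ⋂ n : Fin 2 → ℤ, ⋂ _ : ∃ i, n i < 0,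
      {f : L2Torus | ⟪(UnitAddTorus.mFourierLp 2 n : L2Torus), f⟫_ℂ = 0} := by
    ext f
    simp only [Set.mem_iInter, Set.mem_ofPred_eq, ← mFourierCoeff_eq_inner]
    exact Iff.rfl
  rw [h]
  refine isClosed_iInter fun n => isClosed_iInter fun _ => ?_
  exact isClosed_eq (by fun_prop) continuous_const

instance : CompleteSpace H2 := isClosed_hardySpace.completeSpace_coe

/-! ## Point evaluations: `H²` as a reproducing kernel Hilbert space on the bidisk -/

/-- The coefficient of `z ^ n.1 * w ^ n.2` in the power series of `f`. -/
def coeff (f : H2) (n : ℕ × ℕ) : ℂ :=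
  UnitAddTorus.mFourierCoeff (f : L2Torus) ![(n.1 : ℤ), (n.2 : ℤ)]

lemma coeff_eq_inner (f : H2) (n : ℕ × ℕ) :
    coeff f n
      = ⟪(UnitAddTorus.mFourierLp 2 ![(n.1 : ℤ), (n.2 : ℤ)] : L2Torus), (f : L2Torus)⟫_ℂ :=
  mFourierCoeff_eq_inner _ _

lemma norm_coeff_le (f : H2) (n : ℕ × ℕ) : ‖coeff f n‖ ≤ ‖f‖ := by
  rw [coeff_eq_inner]
  refine (norm_inner_le_norm _ _).trans ?_
  have : ‖(UnitAddTorus.mFourierLp 2 ![(n.1 : ℤ), (n.2 : ℤ)] : L2Torus)‖ = 1 :=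
    (UnitAddTorus.orthonormal_mFourier (d := Fin 2)).1 _
  rw [this, one_mul]
  rfl

lemma summable_norm_monomial (z : Bidisk) :
    Summable fun n : ℕ × ℕ => ‖z.1 0 ^ n.1 * z.1 1 ^ n.2‖ := by
  have h0 : Summable fun n : ℕ => ‖z.1 0‖ ^ n :=
    summable_geometric_of_lt_one (norm_nonneg _) (z.2 0)
  have h1 : Summable fun n : ℕ => ‖z.1 1‖ ^ n :=
    summable_geometric_of_lt_one (norm_nonneg _) (z.2 1)
  have := h0.mul_of_nonneg h1 (fun _ => by positivity) (fun _ => by positivity)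
  simpa [norm_mul, norm_pow] using this

lemma summable_coeff (f : H2) (z : Bidisk) :
    Summable fun n : ℕ × ℕ => coeff f n * (z.1 0 ^ n.1 * z.1 1 ^ n.2) := by
  refine Summable.of_norm_bounded ((summable_norm_monomial z).mul_left ‖f‖) fun n => ?_
  rw [norm_mul]
  exact mul_le_mul_of_nonneg_right (norm_coeff_le f n) (norm_nonneg _)

/-- Evaluation at a point `(z, w)` of the bidisk: the value there of the holomorphic function
`∑ aₘₙ zᵐ wⁿ` whose power series coefficients are the Fourier coefficients of `f`. -/
def evalCLM (z : Bidisk) : H2 →L[ℂ] ℂ :=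
  LinearMap.mkContinuous
    { toFun := fun f => ∑' n : ℕ × ℕ, coeff f n * (z.1 0 ^ n.1 * z.1 1 ^ n.2)
      map_add' := fun f g => by
        rw [← (summable_coeff f z).tsum_add (summable_coeff g z)]
        refine tsum_congr fun n => ?_
        simp only [coeff_eq_inner, Submodule.coe_add, inner_add_right, add_mul]
      map_smul' := fun c f => by
        rw [RingHom.id_apply, smul_eq_mul, ← tsum_mul_left]
        refine tsum_congr fun n => ?_
        simp only [coeff_eq_inner, Submodule.coe_smul, inner_smul_right, mul_assoc] }
    (∑' n : ℕ × ℕ, ‖z.1 0 ^ n.1 * z.1 1 ^ n.2‖)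
    (fun f => by
      have hs := (summable_norm_monomial z).mul_left ‖f‖
      refine (tsum_of_norm_bounded hs.hasSum fun n => ?_).trans ?_
      · rw [norm_mul]
        exact mul_le_mul_of_nonneg_right (norm_coeff_le f n) (norm_nonneg _)
      · rw [tsum_mul_left, mul_comm])

lemma evalCLM_apply (z : Bidisk) (f : H2) :
    evalCLM z f = ∑' n : ℕ × ℕ, coeff f n * (z.1 0 ^ n.1 * z.1 1 ^ n.2) := rfl

/-- A one-variable power series that vanishes on the unit disk has zero coefficients. -/
lemma powerSeries_eq_zero (a : ℕ → ℂ)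
    (h : ∀ z : ℂ, ‖z‖ < 1 → HasSum (fun n => a n * z ^ n) 0) (n : ℕ) : a n = 0 := by
  let p : FormalMultilinearSeries ℂ ℂ ℂ := FormalMultilinearSeries.ofScalars ℂ a
  have hp : HasFPowerSeriesAt (fun _ : ℂ => (0 : ℂ)) p 0 := by
    rw [hasFPowerSeriesAt_iff]
    filter_upwards [Metric.ball_mem_nhds (0 : ℂ) one_pos] with z hz
    have := h z (by simpa using hz)
    simpa [p, FormalMultilinearSeries.coeff_ofScalars, mul_comm] using this
  have h0 := hp.eq_zero
  have : p.coeff n = 0 := by rw [h0]; rfl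
  simpa [p, FormalMultilinearSeries.coeff_ofScalars] using this

lemma coeff_eq_zero_of_eval (f : H2) (h : ∀ z, evalCLM z f = 0) (n : ℕ × ℕ) :
    coeff f n = 0 := by
  have key : ∀ z w : ℂ, ‖z‖ < 1 → ‖w‖ < 1 →
      Summable (fun n : ℕ × ℕ => coeff f n * (z ^ n.1 * w ^ n.2)) ∧
      ∑' n : ℕ × ℕ, coeff f n * (z ^ n.1 * w ^ n.2) = 0 := by
    intro z w hz hw
    let x : Bidisk := ⟨![z, w], fun i => by fin_cases i <;> simpa⟩
    exact ⟨by simpa [x] using summable_coeff f x, by simpa [x, evalCLM_apply] using h x⟩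
  have step1 : ∀ w : ℂ, ‖w‖ < 1 → ∀ m : ℕ, ∑' k : ℕ, coeff f (m, k) * w ^ k = 0 := by
    intro w hw
    refine powerSeries_eq_zero (fun m => ∑' k : ℕ, coeff f (m, k) * w ^ k) fun z hz => ?_
    obtain ⟨hs, h0⟩ := key z w hz hw
    have h1 := hs.prod
    have h2 := hs.tsum_prod
    have h3 : ∀ m : ℕ, ∑' k : ℕ, coeff f (m, k) * (z ^ m * w ^ k)
        = (∑' k : ℕ, coeff f (m, k) * w ^ k) * z ^ m := by
      intro m
      rw [← tsum_mul_right]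
      exact tsum_congr fun k => by ring
    simp only [h3] at h1 h2
    rw [h0] at h2
    rw [h2]
    exact h1.hasSum
  obtain ⟨m, k⟩ := n
  refine powerSeries_eq_zero (fun k => coeff f (m, k)) (fun w hw => ?_) k
  rw [← step1 w hw m]
  refine Summable.hasSum ?_
  refine Summable.of_norm_bounded
    ((summable_geometric_of_lt_one (norm_nonneg w) hw).mul_left ‖f‖) fun k => ?_
  rw [norm_mul, norm_pow]
  exact mul_le_mul_of_nonneg_right (norm_coeff_le f _) (by positivity)

lemma eq_zero_of_eval (f : H2) (h : ∀ z, evalCLM z f = 0) : f = 0 := by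
  apply Subtype.ext
  apply (UnitAddTorus.mFourierBasis (d := Fin 2)).repr.injective
  apply lp.ext
  funext n
  rw [ZeroMemClass.coe_zero, map_zero]
  rw [mFourierBasis_repr']
  by_cases hn : ∃ i, n i < 0
  · exact f.2 n hn
  · push Not at hn
    obtain ⟨a, ha⟩ := Int.eq_ofNat_of_zero_le (hn 0)
    obtain ⟨b, hb⟩ := Int.eq_ofNat_of_zero_le (hn 1)
    have hnn : n = ![(a : ℤ), (b : ℤ)] := by
      funext i
      fin_cases i
      · exact ha
      · exact hb
    rw [hnn]
    exact coeff_eq_zero_of_eval f h (a, b)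

/-- `H²` is a reproducing kernel Hilbert space of functions on the bidisk; for `f : H2` and
`z : Bidisk`, `f z` is the value at `z` of the holomorphic function represented by `f`. -/
instance : RKHS ℂ H2 Bidisk ℂ where
  coeCLM := ContinuousLinearMap.pi evalCLM
  coeCLM_injective := by
    intro f g hfg
    rw [← sub_eq_zero]
    refine eq_zero_of_eval _ fun z => ?_
    have := congrFun hfg z
    rw [map_sub, sub_eq_zero]
    exact this

lemma apply_eq_tsum (f : H2) (z : Bidisk) :
    f z = ∑' n : ℕ × ℕ, coeff f n * (z.1 0 ^ n.1 * z.1 1 ^ n.2) := rfl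

/-- A linear subspace of `H²` inherits the structure of a space of functions on the bidisk. -/
instance (S : Submodule ℂ H2) : RKHS ℂ S Bidisk ℂ where
  coeCLM := (RKHS.coeCLM ℂ : H2 →L[ℂ] Bidisk → ℂ) ∘L S.subtypeL
  coeCLM_injective := (RKHS.coeCLM_injective (𝕜 := ℂ) (H := H2)).comp Subtype.val_injective

/-! ## Polynomials and coordinate multiplication -/

/-- Multiplication of `L²` functions on the torus by a continuous function. -/
def mulL2 (g : C(Torus, ℂ)) : L2Torus →L[ℂ] L2Torus :=
  (ContinuousLinearMap.mul ℂ ℂ).holderL torusMeasure ∞ 2 2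
    (ContinuousMap.toLp (E := ℂ) ∞ torusMeasure ℂ g)

lemma coeFn_mulL2 (g : C(Torus, ℂ)) (f : L2Torus) :
    mulL2 g f =ᵐ[torusMeasure] fun t => g t * f t := by
  have h1 := (ContinuousLinearMap.mul ℂ ℂ).coeFn_holder (r := 2)
    (ContinuousMap.toLp (E := ℂ) ∞ torusMeasure ℂ g) f
  have h2 := ContinuousMap.coeFn_toLp (p := ∞) (𝕜 := ℂ) torusMeasure g
  filter_upwards [h1, h2] with t ht1 ht2
  rw [← ht2]
  exact ht1

lemma mFourier_single_eq (i : Fin 2) : UnitAddTorus.mFourier (Pi.single i 1) = coord i := by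
  ext t
  exact UnitAddTorus.mFourier_single t i

lemma mFourierCoeff_mulL2 (i : Fin 2) (f : L2Torus) (n : Fin 2 → ℤ) :
    UnitAddTorus.mFourierCoeff (mulL2 (coord i) f) n
      = UnitAddTorus.mFourierCoeff f (n - Pi.single i 1) := by
  refine integral_congr_ae ?_
  filter_upwards [coeFn_mulL2 (coord i) f] with t ht
  rw [ht, ← mFourier_single_eq, neg_sub, sub_eq_add_neg, add_comm, UnitAddTorus.mFourier_add,
    smul_eq_mul, smul_eq_mul]
  ring

lemma mulL2_coord_mem (i : Fin 2) {f : L2Torus} (hf : f ∈ hardySpace) :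
    mulL2 (coord i) f ∈ hardySpace := by
  rintro n ⟨j, hj⟩
  rw [mFourierCoeff_mulL2]
  refine hf _ ⟨j, ?_⟩
  by_cases hij : j = i
  · subst hij; simp; omega
  · simpa [hij] using hj

/-- Multiplication by the `i`-th coordinate function (`z` for `i = 0`, `w` for `i = 1`) on `H²`. -/
def shift (i : Fin 2) : H2 →L[ℂ] H2 :=
  ((mulL2 (coord i)).comp hardySpace.subtypeL).codRestrict hardySpace
    fun f => mulL2_coord_mem i f.2

lemma coe_shift (i : Fin 2) (f : H2) : (shift i f : L2Torus) = mulL2 (coord i) f := rfl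

lemma toLp_aeval_mem (p : MvPolynomial (Fin 2) ℂ) :
    ContinuousMap.toLp (E := ℂ) 2 torusMeasure ℂ (MvPolynomial.aeval coord p) ∈ hardySpace := by
  induction p using MvPolynomial.induction_on with
  | C a =>
    rintro n ⟨j, hj⟩
    have h : (MvPolynomial.aeval coord (MvPolynomial.C a) : C(Torus, ℂ))
        = a • UnitAddTorus.mFourier 0 := by
      rw [MvPolynomial.aeval_C, UnitAddTorus.mFourier_zero, Algebra.algebraMap_eq_smul_one]
    have hn : n ≠ 0 := by
      rintro rfl
      simp at hj
    have h2 := (UnitAddTorus.orthonormal_mFourier (d := Fin 2)).2 hn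
    rw [mFourierCoeff_eq_inner, h, map_smul, inner_smul_right]
    exact mul_eq_zero_of_right _ h2
  | add p q hp hq =>
    rw [map_add, map_add]
    exact add_mem hp hq
  | mul_X p i hp =>
    have h := mulL2_coord_mem i hp
    convert h using 1
    apply Lp.ext
    have h1 := coeFn_mulL2 (coord i)
      (ContinuousMap.toLp (E := ℂ) 2 torusMeasure ℂ (MvPolynomial.aeval coord p))
    have h2 := ContinuousMap.coeFn_toLp (p := 2) (𝕜 := ℂ) torusMeasure
      (MvPolynomial.aeval coord p : C(Torus, ℂ))
    have h3 := ContinuousMap.coeFn_toLp (p := 2) (𝕜 := ℂ) torusMeasure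
      (MvPolynomial.aeval coord (p * MvPolynomial.X i) : C(Torus, ℂ))
    filter_upwards [h1, h2, h3] with t ht1 ht2 ht3
    rw [ht1, ht2, ht3, map_mul, MvPolynomial.aeval_X, ContinuousMap.mul_apply, mul_comm]

/-- A polynomial in the two coordinates as an element of `H²`: its boundary function on the torus
is obtained by substituting the coordinate functions for the variables. -/
def ofPolynomial (p : MvPolynomial (Fin 2) ℂ) : H2 :=
  ⟨ContinuousMap.toLp (E := ℂ) 2 torusMeasure ℂ (MvPolynomial.aeval coord p), toLp_aeval_mem p⟩

/-! ## Submodules -/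

/-- A submodule of the Hardy module: a closed subspace of `H²` that is invariant under
multiplication by both coordinate functions. -/
structure HardySubmodule where
  /-- The underlying linear subspace. -/
  toSubmodule : Submodule ℂ H2
  isClosed : IsClosed (toSubmodule : Set H2)
  shift_mem : ∀ (i : Fin 2) (f : H2), f ∈ toSubmodule → shift i f ∈ toSubmodule

instance (M : HardySubmodule) : CompleteSpace M.toSubmodule := M.isClosed.completeSpace_coe

/-- The submodule `[f]` generated by `f`: the smallest submodule that contains `f`. -/
def HardySubmodule.generatedBy (f : H2) : HardySubmodule where
  toSubmodule := sInf {S : Submodule ℂ H2 | ∃ M : HardySubmodule, f ∈ M.toSubmodule ∧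
    M.toSubmodule = S}
  isClosed := by
    rw [Submodule.coe_sInf]
    refine isClosed_biInter ?_
    rintro S ⟨M, -, rfl⟩
    exact M.isClosed
  shift_mem := by
    intro i g hg
    rw [Submodule.mem_sInf] at hg ⊢
    rintro S ⟨M, hM, rfl⟩
    exact M.shift_mem i g (hg _ ⟨M, hM, rfl⟩)

/-! ## The core function and the core operator -/

/-- The reproducing kernel of `M` at the point `z` of the bidisk, i.e. the function
`K^M(z, ·)` of `M` with `f z = ⟪K^M(z, ·), f⟫` for all `f` in `M`. -/
def reproducingKernel (M : HardySubmodule) (z : Bidisk) : M.toSubmodule :=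
  RKHS.kerFun M.toSubmodule z (1 : ℂ)

lemma inner_reproducingKernel (M : HardySubmodule) (z : Bidisk) (f : M.toSubmodule) :
    ⟪reproducingKernel M z, f⟫_ℂ = (f : H2) z := by
  rw [reproducingKernel, RKHS.kerFun_inner]
  simp only [RCLike.inner_apply, map_one, mul_one]
  rfl

/-- The core function `G^M(λ, z) = (1 - conj λ₁ z₁) (1 - conj λ₂ z₂) K^M(λ, z)` for `λ` on the torus
(given by its parameter `t`) and `z` in the bidisk. The boundary value of `K^M(λ, z)` in `λ` is
read off from `K^M(λ, z) = conj (K^M(z, λ))`, where `K^M(z, ·)` belongs to `H²` and so has boundary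
values almost everywhere on the torus. -/
def coreFunction (M : HardySubmodule) (t : Torus) (z : Bidisk) : ℂ :=
  (1 - conj (coord 0 t) * z.1 0) * (1 - conj (coord 1 t) * z.1 1)
    * conj (((reproducingKernel M z : H2) : L2Torus) t)

/-- `C` is the core operator of `M`: for all `f` in `H²` and all `z` in the bidisk,
`(C f)(z)` is the integral of `G^M(λ, z) f(λ)` over the torus. -/
def IsCoreOperator (M : HardySubmodule) (C : H2 →L[ℂ] H2) : Prop :=
  ∀ (f : H2) (z : Bidisk),
    Integrable (fun t => coreFunction M t z * (f : L2Torus) t) torusMeasure ∧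
    (C f) z = ∫ t, coreFunction M t z * (f : L2Torus) t ∂torusMeasure

lemma coeff_shift_zero (f : H2) (n : ℕ × ℕ) :
    coeff (shift 0 f) (n.1 + 1, n.2) = coeff f n := by
  rw [coeff, coe_shift, mFourierCoeff_mulL2, coeff]
  congr 1
  funext i
  fin_cases i <;> simp

lemma coeff_shift_one (f : H2) (n : ℕ × ℕ) :
    coeff (shift 1 f) (n.1, n.2 + 1) = coeff f n := by
  rw [coeff, coe_shift, mFourierCoeff_mulL2, coeff]
  congr 1
  funext i
  fin_cases i <;> simp

lemma coeff_shift_zero' (f : H2) (k : ℕ) : coeff (shift 0 f) (0, k) = 0 := by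
  rw [coeff, coe_shift, mFourierCoeff_mulL2]
  exact f.2 _ ⟨0, by simp⟩

lemma coeff_shift_one' (f : H2) (k : ℕ) : coeff (shift 1 f) (k, 0) = 0 := by
  rw [coeff, coe_shift, mFourierCoeff_mulL2]
  exact f.2 _ ⟨1, by simp⟩

lemma shift_apply (i : Fin 2) (f : H2) (z : Bidisk) : (shift i f) z = z.1 i * f z := by
  rw [apply_eq_tsum, apply_eq_tsum, ← tsum_mul_left]
  fin_cases i
  · have hinj : Function.Injective (fun n : ℕ × ℕ => (n.1 + 1, n.2)) := by
      rintro ⟨a, b⟩ ⟨c, d⟩ h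
      simpa using h
    rw [← hinj.tsum_eq]
    · refine tsum_congr fun n => ?_
      change coeff (shift 0 f) (n.1 + 1, n.2) * _ = _
      rw [coeff_shift_zero]
      simp only [Fin.zero_eta]
      ring
    · rintro ⟨a, b⟩ h
      rcases a with _ | a
      · exact absurd (by simp [coeff_shift_zero']) h
      · exact ⟨(a, b), rfl⟩
  · have hinj : Function.Injective (fun n : ℕ × ℕ => (n.1, n.2 + 1)) := by
      rintro ⟨a, b⟩ ⟨c, d⟩ h
      simpa using h
    rw [← hinj.tsum_eq]
    · refine tsum_congr fun n => ?_
      change coeff (shift 1 f) (n.1, n.2 + 1) * _ = _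
      rw [coeff_shift_one]
      simp only [Fin.mk_one]
      ring
    · rintro ⟨a, b⟩ h
      rcases b with _ | b
      · exact absurd (by simp [coeff_shift_one']) h
      · exact ⟨(a, b), rfl⟩

lemma inner_starProjection_reproducingKernel (M : HardySubmodule) (z : Bidisk) (g : H2) :
    (M.toSubmodule.starProjection g) z = ⟪(reproducingKernel M z : H2), g⟫_ℂ := by
  rw [Submodule.starProjection_apply, ← inner_reproducingKernel, Submodule.coe_inner]
  rw [← Submodule.starProjection_apply, ← Submodule.inner_starProjection_left_eq_right]
  rw [Submodule.starProjection_eq_self_iff.2 (reproducingKernel M z).2]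

/-- The core operator exists and is unique. -/
theorem existsUnique_coreOperator (M : HardySubmodule) : ∃! C, IsCoreOperator M C := by
  let T : Fin 2 → (H2 →L[ℂ] H2) := shift
  let S : Fin 2 → (H2 →L[ℂ] H2) := fun i => ContinuousLinearMap.adjoint (T i)
  let P : H2 →L[ℂ] H2 := M.toSubmodule.starProjection
  refine existsUnique_of_exists_of_unique
    ⟨P - T 0 ∘L P ∘L S 0 - T 1 ∘L P ∘L S 1 + T 0 ∘L T 1 ∘L P ∘L S 1 ∘L S 0, ?_⟩ ?_
  · intro f z
    set K : H2 := (reproducingKernel M z : H2) with hK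
    have hP : ∀ g : H2, (P g) z = ⟪K, g⟫_ℂ := inner_starProjection_reproducingKernel M z
    have hS : ∀ i (g h : H2), ⟪g, S i h⟫_ℂ = ⟪T i g, h⟫_ℂ := fun i g h =>
      ContinuousLinearMap.adjoint_inner_right (T i) g h
    have hT : ∀ i (g : H2), (T i g) z = z.1 i * g z := fun i g => shift_apply i g z
    set U : H2 := K - conj (z.1 0) • T 0 K - conj (z.1 1) • T 1 K
      + (conj (z.1 0) * conj (z.1 1)) • T 0 (T 1 K) with hU
    have hae : (fun t => coreFunction M t z * (f : L2Torus) t) =ᵐ[torusMeasure]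
        fun t => ⟪(U : L2Torus) t, (f : L2Torus) t⟫_ℂ := by
      have e0 := coeFn_mulL2 (coord 0) (K : L2Torus)
      have e1 := coeFn_mulL2 (coord 1) (K : L2Torus)
      have e01 := coeFn_mulL2 (coord 0) (mulL2 (coord 1) (K : L2Torus))
      have hUc : (U : L2Torus) = (K : L2Torus) - conj (z.1 0) • mulL2 (coord 0) (K : L2Torus)
          - conj (z.1 1) • mulL2 (coord 1) (K : L2Torus)
          + (conj (z.1 0) * conj (z.1 1)) • mulL2 (coord 0) (mulL2 (coord 1) (K : L2Torus)) := rfl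
      rw [hUc]
      filter_upwards [e0, e1, e01,
        Lp.coeFn_add ((K : L2Torus) - conj (z.1 0) • mulL2 (coord 0) (K : L2Torus)
          - conj (z.1 1) • mulL2 (coord 1) (K : L2Torus))
          ((conj (z.1 0) * conj (z.1 1)) • mulL2 (coord 0) (mulL2 (coord 1) (K : L2Torus))),
        Lp.coeFn_sub ((K : L2Torus) - conj (z.1 0) • mulL2 (coord 0) (K : L2Torus))
          (conj (z.1 1) • mulL2 (coord 1) (K : L2Torus)),
        Lp.coeFn_sub (K : L2Torus) (conj (z.1 0) • mulL2 (coord 0) (K : L2Torus)),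
        Lp.coeFn_smul (conj (z.1 0)) (mulL2 (coord 0) (K : L2Torus)),
        Lp.coeFn_smul (conj (z.1 1)) (mulL2 (coord 1) (K : L2Torus)),
        Lp.coeFn_smul (conj (z.1 0) * conj (z.1 1))
          (mulL2 (coord 0) (mulL2 (coord 1) (K : L2Torus)))]
        with t a0 a1 a01 b1 b2 b3 c1 c2 c3
      rw [b1, Pi.add_apply, b2, Pi.sub_apply, b3, Pi.sub_apply, c1, c2, c3]
      simp only [Pi.smul_apply, smul_eq_mul, a0, a1, a01, coreFunction, RCLike.inner_apply,
        map_add, map_sub, map_mul, Complex.conj_conj, ← hK]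
      ring
    refine ⟨(integrable_congr hae).2 (L2.integrable_inner (𝕜 := ℂ) (U : L2Torus) (f : L2Torus)),
      ?_⟩
    rw [integral_congr_ae hae, ← L2.inner_def, ← Submodule.coe_inner]
    simp only [add_apply, sub_apply,
      ContinuousLinearMap.comp_apply, RKHS.coe_add, RKHS.coe_sub, Pi.add_apply, Pi.sub_apply,
      hT, hP, hS, hU, inner_add_left, inner_sub_left, inner_smul_left, map_mul, Complex.conj_conj]
    ring
  · intro C D hC hD
    refine ContinuousLinearMap.ext fun f => RKHS.ext fun z => ?_
    rw [(hC f z).2, (hD f z).2]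

/-- The core operator of the submodule `M`, as a bounded operator on `H²`. -/
def coreOperator (M : HardySubmodule) : H2 →L[ℂ] H2 := (existsUnique_coreOperator M).choose

lemma isCoreOperator_coreOperator (M : HardySubmodule) : IsCoreOperator M (coreOperator M) :=
  (existsUnique_coreOperator M).choose_spec.1

end HardyBidisk

end

/-!
The eigenvalues of the core operator `C` of `[(z - w) ^ 2]` are found one homogeneous degree at a
time. If `P` is the projection onto a submodule and `T₀, T₁` are the coordinate shifts, then
`C = P - T₀ P T₀* - T₁ P T₁* + T₀ T₁ P T₁* T₀*` (`coreOperator_eq`). For `[(z - w) ^ 2]` every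
operator here is compatible with the grading of `H²` by total degree, so `C` is determined by its
action on the coefficients along each antidiagonal `i + j = d`.

A function orthogonal to all `z ^ i * w ^ j * (z - w) ^ 2` has vanishing second differences along
antidiagonals, hence coefficients affine in `i - j`; a function in the submodule has, in each
degree, coefficients with vanishing sum and vanishing first moment. These two facts together
identify `P` as subtraction of the least squares affine fit (`coeff_starProjection`), without a
description of the submodule as a closure.

Inserting the explicit fits in degrees `d`, `d - 1` and `d - 2` into the formula for `C` gives, in
degree `d ≥ 3`, the difference of two rank one operators with orthogonal ranges, one spanned by a
symmetric and one by an antisymmetric vector, each of norm `2 / d` (`coeff_coreOperator`). So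
degree `d` contributes exactly the nonzero eigenvalues `2 / d` and `-2 / d`. In degree `2` the
antisymmetric part is absent and only the eigenvalue `1` is left, with eigenvector a multiple of
`(z - w) ^ 2`; in degrees `0` and `1` the operator is zero.
-/

open MeasureTheory ComplexConjugate
open scoped ENNReal InnerProductSpace

namespace HardyBidisk

open Finset.HasAntidiagonal (antidiagonal)

/-! ### Power series coefficients and monomials -/

lemma coeff_add (f g : H2) (n : ℕ × ℕ) : coeff (f + g) n = coeff f n + coeff g n := by
  simp only [coeff_eq_inner, Submodule.coe_add, inner_add_right]

lemma coeff_sub (f g : H2) (n : ℕ × ℕ) : coeff (f - g) n = coeff f n - coeff g n := by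
  simp only [coeff_eq_inner, AddSubgroupClass.coe_sub, inner_sub_right]

lemma coeff_smul (c : ℂ) (f : H2) (n : ℕ × ℕ) : coeff (c • f) n = c * coeff f n := by
  simp only [coeff_eq_inner, Submodule.coe_smul, inner_smul_right]

lemma coeff_sum {ι : Type*} (s : Finset ι) (f : ι → H2) (n : ℕ × ℕ) :
    coeff (∑ i ∈ s, f i) n = ∑ i ∈ s, coeff (f i) n := by
  simp only [coeff_eq_inner, Submodule.coe_sum, inner_sum]

lemma continuous_coeff (n : ℕ × ℕ) : Continuous fun f : H2 => coeff f n := by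
  simp only [coeff_eq_inner]
  fun_prop

lemma ext_coeff {f g : H2} (h : ∀ n, coeff f n = coeff g n) : f = g := by
  rw [← sub_eq_zero]
  refine eq_zero_of_eval _ fun z => ?_
  rw [evalCLM_apply]
  simp [coeff_sub, h]

/-- The monomial `z ^ n.1 * w ^ n.2` as an element of `H²`. -/
noncomputable def monomial (n : ℕ × ℕ) : H2 :=
  ⟨UnitAddTorus.mFourierLp 2 ![(n.1 : ℤ), (n.2 : ℤ)], by
    rintro m ⟨j, hj⟩
    rw [mFourierCoeff_eq_inner]
    refine (UnitAddTorus.orthonormal_mFourier (d := Fin 2)).2 ?_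
    rintro rfl
    fin_cases j <;> simp at hj <;> omega⟩

lemma inner_monomial (n : ℕ × ℕ) (f : H2) : ⟪monomial n, f⟫_ℂ = coeff f n :=
  (coeff_eq_inner f n).symm

lemma coeff_monomial (n m : ℕ × ℕ) : coeff (monomial n) m = if m = n then 1 else 0 := by
  rw [coeff_eq_inner]
  have h := (orthonormal_iff_ite.1 (UnitAddTorus.orthonormal_mFourier (d := Fin 2)))
    ![(m.1 : ℤ), (m.2 : ℤ)] ![(n.1 : ℤ), (n.2 : ℤ)]
  refine h.trans ?_
  congr 1
  simp [Prod.ext_iff]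

lemma shift_zero_monomial (n : ℕ × ℕ) : shift 0 (monomial n) = monomial (n.1 + 1, n.2) := by
  refine ext_coeff fun ⟨i, j⟩ => ?_
  rcases i with _ | i
  · rw [coeff_shift_zero', coeff_monomial]
    simp
  · rw [coeff_shift_zero _ (i, j), coeff_monomial, coeff_monomial]
    simp [Prod.ext_iff]

lemma shift_one_monomial (n : ℕ × ℕ) : shift 1 (monomial n) = monomial (n.1, n.2 + 1) := by
  refine ext_coeff fun ⟨i, j⟩ => ?_
  rcases j with _ | j
  · rw [coeff_shift_one', coeff_monomial]
    simp
  · rw [coeff_shift_one _ (i, j), coeff_monomial, coeff_monomial]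
    simp [Prod.ext_iff]

lemma coeff_adjoint_shift_zero (f : H2) (n : ℕ × ℕ) :
    coeff (ContinuousLinearMap.adjoint (shift 0) f) n = coeff f (n.1 + 1, n.2) := by
  rw [← inner_monomial, ContinuousLinearMap.adjoint_inner_right, shift_zero_monomial,
    inner_monomial]

lemma coeff_adjoint_shift_one (f : H2) (n : ℕ × ℕ) :
    coeff (ContinuousLinearMap.adjoint (shift 1) f) n = coeff f (n.1, n.2 + 1) := by
  rw [← inner_monomial, ContinuousLinearMap.adjoint_inner_right, shift_one_monomial,
    inner_monomial]

lemma ofPolynomial_sq_sub :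
    ofPolynomial ((MvPolynomial.X 0 - MvPolynomial.X 1) ^ 2)
      = monomial (2, 0) - (2 : ℂ) • monomial (1, 1) + monomial (0, 2) := by
  have key : (MvPolynomial.aeval coord
        ((MvPolynomial.X 0 - MvPolynomial.X 1) ^ 2 : MvPolynomial (Fin 2) ℂ) : C(Torus, ℂ))
      = UnitAddTorus.mFourier ![((2 : ℕ) : ℤ), ((0 : ℕ) : ℤ)]
        - (2 : ℂ) • UnitAddTorus.mFourier ![((1 : ℕ) : ℤ), ((1 : ℕ) : ℤ)]
        + UnitAddTorus.mFourier ![((0 : ℕ) : ℤ), ((2 : ℕ) : ℤ)] := by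
    have e : ∀ n : Fin 2 → ℤ, ∀ t, UnitAddTorus.mFourier n t
        = fourier (n 0) (t 0) * fourier (n 1) (t 1) := fun n t => by
      simp [UnitAddTorus.mFourier, Fin.prod_univ_two]
    ext t
    simp only [map_pow, map_sub, MvPolynomial.aeval_X, ContinuousMap.pow_apply,
      ContinuousMap.sub_apply, ContinuousMap.add_apply, ContinuousMap.smul_apply, e, coord,
      ContinuousMap.coe_mk]
    have h2 : ∀ x : UnitAddCircle, (fourier 2 x : ℂ) = fourier 1 x * fourier 1 x :=
      fun x => by rw [← fourier_add]; norm_num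
    simp only [Matrix.cons_val_zero, Matrix.cons_val_one, Nat.cast_ofNat, Nat.cast_one,
      Nat.cast_zero, fourier_zero, h2, smul_eq_mul]
    ring
  apply Subtype.ext
  change ContinuousMap.toLp (E := ℂ) 2 torusMeasure ℂ _ = _
  rw [key, map_add, map_sub, map_smul]
  rfl

/-! ### The core operator in terms of the orthogonal projection -/

/-- The core operator is the alternating sum of the operators `T P T*`, where `P` is the orthogonal
projection onto `M` and `T` runs over the products of distinct coordinate shifts. -/
theorem coreOperator_eq (M : HardySubmodule) :
    coreOperator M = M.toSubmodule.starProjection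
      - shift 0 ∘L M.toSubmodule.starProjection ∘L ContinuousLinearMap.adjoint (shift 0)
      - shift 1 ∘L M.toSubmodule.starProjection ∘L ContinuousLinearMap.adjoint (shift 1)
      + shift 0 ∘L shift 1 ∘L M.toSubmodule.starProjection
        ∘L ContinuousLinearMap.adjoint (shift 1) ∘L ContinuousLinearMap.adjoint (shift 0) := by
  refine (existsUnique_coreOperator M).unique (isCoreOperator_coreOperator M) ?_
  let T : Fin 2 → (H2 →L[ℂ] H2) := shift
  let S : Fin 2 → (H2 →L[ℂ] H2) := fun i => ContinuousLinearMap.adjoint (T i)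
  let P : H2 →L[ℂ] H2 := M.toSubmodule.starProjection
  change IsCoreOperator M
    (P - T 0 ∘L P ∘L S 0 - T 1 ∘L P ∘L S 1 + T 0 ∘L T 1 ∘L P ∘L S 1 ∘L S 0)
  intro f z
  set K : H2 := (reproducingKernel M z : H2) with hK
  have hP : ∀ g : H2, (P g) z = ⟪K, g⟫_ℂ := inner_starProjection_reproducingKernel M z
  have hS : ∀ i (g h : H2), ⟪g, S i h⟫_ℂ = ⟪T i g, h⟫_ℂ := fun i g h =>
    ContinuousLinearMap.adjoint_inner_right (T i) g h
  have hT : ∀ i (g : H2), (T i g) z = z.1 i * g z := fun i g => shift_apply i g z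
  -- `U` is chosen so that its boundary function is the conjugate of the core function at `z`.
  set U : H2 := K - conj (z.1 0) • T 0 K - conj (z.1 1) • T 1 K
    + (conj (z.1 0) * conj (z.1 1)) • T 0 (T 1 K) with hU
  have hae : (fun t => coreFunction M t z * (f : L2Torus) t) =ᵐ[torusMeasure]
      fun t => ⟪(U : L2Torus) t, (f : L2Torus) t⟫_ℂ := by
    have e0 := coeFn_mulL2 (coord 0) (K : L2Torus)
    have e1 := coeFn_mulL2 (coord 1) (K : L2Torus)
    have e01 := coeFn_mulL2 (coord 0) (mulL2 (coord 1) (K : L2Torus))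
    have hUc : (U : L2Torus) = (K : L2Torus) - conj (z.1 0) • mulL2 (coord 0) (K : L2Torus)
        - conj (z.1 1) • mulL2 (coord 1) (K : L2Torus)
        + (conj (z.1 0) * conj (z.1 1)) • mulL2 (coord 0) (mulL2 (coord 1) (K : L2Torus)) := rfl
    rw [hUc]
    filter_upwards [e0, e1, e01,
      Lp.coeFn_add ((K : L2Torus) - conj (z.1 0) • mulL2 (coord 0) (K : L2Torus)
        - conj (z.1 1) • mulL2 (coord 1) (K : L2Torus))
        ((conj (z.1 0) * conj (z.1 1)) • mulL2 (coord 0) (mulL2 (coord 1) (K : L2Torus))),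
      Lp.coeFn_sub ((K : L2Torus) - conj (z.1 0) • mulL2 (coord 0) (K : L2Torus))
        (conj (z.1 1) • mulL2 (coord 1) (K : L2Torus)),
      Lp.coeFn_sub (K : L2Torus) (conj (z.1 0) • mulL2 (coord 0) (K : L2Torus)),
      Lp.coeFn_smul (conj (z.1 0)) (mulL2 (coord 0) (K : L2Torus)),
      Lp.coeFn_smul (conj (z.1 1)) (mulL2 (coord 1) (K : L2Torus)),
      Lp.coeFn_smul (conj (z.1 0) * conj (z.1 1))
        (mulL2 (coord 0) (mulL2 (coord 1) (K : L2Torus)))]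
      with t a0 a1 a01 b1 b2 b3 c1 c2 c3
    rw [b1, Pi.add_apply, b2, Pi.sub_apply, b3, Pi.sub_apply, c1, c2, c3]
    simp only [Pi.smul_apply, smul_eq_mul, a0, a1, a01, coreFunction, RCLike.inner_apply,
      map_add, map_sub, map_mul, Complex.conj_conj, ← hK]
    ring
  refine ⟨(integrable_congr hae).2 (L2.integrable_inner (𝕜 := ℂ) (U : L2Torus) (f : L2Torus)),
    ?_⟩
  rw [integral_congr_ae hae, ← L2.inner_def, ← Submodule.coe_inner]
  simp only [add_apply, sub_apply,
    ContinuousLinearMap.comp_apply, RKHS.coe_add, RKHS.coe_sub, Pi.add_apply, Pi.sub_apply,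
    hT, hP, hS, hU, inner_add_left, inner_sub_left, inner_smul_left, map_mul, Complex.conj_conj]
  ring

/-! ### Sums along antidiagonals -/

/-- The sum of the entries of `a` of total degree `d`. -/
noncomputable def diagSum (a : ℕ × ℕ → ℂ) (d : ℕ) : ℂ := ∑ n ∈ antidiagonal d, a n

/-- The first moment, about the midpoint, of the entries of `a` of total degree `d`; the position
of the entry `(i, j)` is measured by `i - j`. -/
noncomputable def diagMoment (a : ℕ × ℕ → ℂ) (d : ℕ) : ℂ :=
  ∑ n ∈ antidiagonal d, ((n.1 : ℂ) - n.2) * a n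

/-- The value at `n` of the least squares fit, by a function affine in `i - j`, to the entries of
`a` of the same total degree as `n`. In degree zero the second term is `0 / 0 = 0`. -/
noncomputable def affineFit (a : ℕ × ℕ → ℂ) (n : ℕ × ℕ) : ℂ :=
  diagSum a (n.1 + n.2) / ((n.1 + n.2 : ℕ) + 1)
    + 3 * ((n.1 : ℂ) - n.2) * diagMoment a (n.1 + n.2)
      / ((n.1 + n.2 : ℕ) * ((n.1 + n.2 : ℕ) + 1) * ((n.1 + n.2 : ℕ) + 2))

lemma sum_antidiagonal_one (d : ℕ) : ∑ _n ∈ antidiagonal d, (1 : ℂ) = d + 1 := by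
  simp

lemma sum_antidiagonal_sub (d : ℕ) : ∑ n ∈ antidiagonal d, ((n.1 : ℂ) - n.2) = 0 := by
  induction d with
  | zero => simp
  | succ d ih =>
    rw [Finset.Nat.sum_antidiagonal_succ]
    have : ∀ n : ℕ × ℕ, (((n.1 + 1 : ℕ) : ℂ) - n.2) = ((n.1 : ℂ) - n.2) + 1 := fun n => by
      push_cast; ring
    simp only [this, Finset.sum_add_distrib, ih, sum_antidiagonal_one]
    push_cast; ring

lemma sum_antidiagonal_sub_sq (d : ℕ) :
    ∑ n ∈ antidiagonal d, ((n.1 : ℂ) - n.2) ^ 2 = d * (d + 1) * (d + 2) / 3 := by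
  induction d with
  | zero => simp
  | succ d ih =>
    rw [Finset.Nat.sum_antidiagonal_succ]
    have : ∀ n : ℕ × ℕ, (((n.1 + 1 : ℕ) : ℂ) - n.2) ^ 2
        = ((n.1 : ℂ) - n.2) ^ 2 + 2 * ((n.1 : ℂ) - n.2) + 1 := fun n => by
      push_cast; ring
    simp only [this, Finset.sum_add_distrib, ih, sum_antidiagonal_one, ← Finset.mul_sum,
      sum_antidiagonal_sub]
    push_cast; ring

/-- A doubly indexed sequence whose second differences along antidiagonals vanish is affine on each
antidiagonal. -/
lemma exists_affine_of_second_difference {a : ℕ × ℕ → ℂ}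
    (h : ∀ i j, a (i + 2, j) - 2 * a (i + 1, j + 1) + a (i, j + 2) = 0) (d : ℕ) :
    ∃ α β : ℂ, ∀ n : ℕ × ℕ, n.1 + n.2 = d → a n = α + β * ((n.1 : ℂ) - n.2) := by
  rcases d with _ | d
  · refine ⟨a (0, 0), 0, fun ⟨i, j⟩ hn => ?_⟩
    obtain ⟨rfl, rfl⟩ : i = 0 ∧ j = 0 := by simp at hn; exact hn
    simp
  · obtain ⟨β, hβ⟩ : ∃ β, a (1, d) - a (0, d + 1) = 2 * β :=
      ⟨_, (mul_div_cancel₀ _ two_ne_zero).symm⟩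
    obtain ⟨α, hα⟩ : ∃ α, a (0, d + 1) = α - β * (d + 1) := ⟨_, (sub_eq_of_eq_add rfl).symm⟩
    have key : ∀ i, (∀ j, i + j = d + 1 → a (i, j) = α + β * ((i : ℂ) - j)) ∧
        (∀ j, i + 1 + j = d + 1 → a (i + 1, j) = α + β * ((i + 1 : ℂ) - j)) := by
      intro i
      induction i with
      | zero =>
        refine ⟨fun j hj => ?_, fun j hj => ?_⟩
        · obtain rfl : j = d + 1 := by omega
          rw [hα]; push_cast; ring
        · obtain rfl : j = d := by omega
          rw [show (0 + 1, j) = (1, j) from rfl]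
          push_cast
          linear_combination hβ + hα
      | succ i ih =>
        refine ⟨fun j hj => ?_, fun j hj => ?_⟩
        · rw [ih.2 j hj]; push_cast; ring
        · have h1 := ih.1 (j + 2) (by omega)
          have h2 := ih.2 (j + 1) (by omega)
          have h3 := h i j
          rw [h1, h2] at h3
          push_cast at h3 ⊢
          linear_combination h3
    exact ⟨α, β, fun ⟨i, j⟩ hn => (key i).1 j hn⟩

lemma affineFit_eq_self {a : ℕ × ℕ → ℂ}
    (h : ∀ i j, a (i + 2, j) - 2 * a (i + 1, j + 1) + a (i, j + 2) = 0) (n : ℕ × ℕ) :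
    affineFit a n = a n := by
  obtain ⟨α, β, hαβ⟩ := exists_affine_of_second_difference h (n.1 + n.2)
  have hS : diagSum a (n.1 + n.2) = α * ((n.1 + n.2 : ℕ) + 1) := by
    rw [diagSum, Finset.sum_congr rfl fun m hm => hαβ m (by simpa using hm),
      Finset.sum_add_distrib, ← Finset.mul_sum, sum_antidiagonal_sub, Finset.sum_const]
    simp
    ring
  have hD : diagMoment a (n.1 + n.2)
      = β * ((n.1 + n.2 : ℕ) * ((n.1 + n.2 : ℕ) + 1) * ((n.1 + n.2 : ℕ) + 2) / 3) := by
    have e : ∀ m ∈ antidiagonal (n.1 + n.2), ((m.1 : ℂ) - m.2) * a m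
        = α * ((m.1 : ℂ) - m.2) + β * ((m.1 : ℂ) - m.2) ^ 2 := fun m hm => by
      rw [hαβ m (by simpa using hm)]; ring
    rw [diagMoment, Finset.sum_congr rfl e, Finset.sum_add_distrib, ← Finset.mul_sum,
      ← Finset.mul_sum, sum_antidiagonal_sub, sum_antidiagonal_sub_sq]
    ring
  have h1 : ((n.1 + n.2 : ℕ) : ℂ) + 1 ≠ 0 := Nat.cast_add_one_ne_zero _
  have h2 : ((n.1 + n.2 : ℕ) : ℂ) + 2 ≠ 0 := by exact_mod_cast Nat.succ_ne_zero (n.1 + n.2 + 1)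
  rw [affineFit, hS, hD, hαβ n rfl, mul_div_cancel_right₀ _ h1]
  rcases Nat.eq_zero_or_pos (n.1 + n.2) with h0 | h0
  · have h01 : n.1 = 0 := by omega
    have h02 : n.2 = 0 := by omega
    simp [h01, h02]
  · have h3 : ((n.1 + n.2 : ℕ) : ℂ) ≠ 0 := by exact_mod_cast h0.ne'
    field_simp

lemma affineFit_congr {a b : ℕ × ℕ → ℂ} (hS : ∀ d, diagSum a d = diagSum b d)
    (hD : ∀ d, diagMoment a d = diagMoment b d) (n : ℕ × ℕ) : affineFit a n = affineFit b n := by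
  rw [affineFit, affineFit, hS, hD]

/-! ### The submodule generated by `(z - w) ^ 2` -/

/-- The submodule `[(z - w) ^ 2]`. -/
noncomputable abbrev diffSqSubmodule : HardySubmodule :=
  HardySubmodule.generatedBy (ofPolynomial ((MvPolynomial.X 0 - MvPolynomial.X 1) ^ 2))

lemma HardySubmodule.mem_generatedBy_self (f : H2) :
    f ∈ (HardySubmodule.generatedBy f).toSubmodule := by
  refine Submodule.mem_sInf.2 ?_
  rintro S ⟨M, hM, rfl⟩
  exact hM

lemma HardySubmodule.generatedBy_le {f : H2} {M : HardySubmodule} (h : f ∈ M.toSubmodule) :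
    (HardySubmodule.generatedBy f).toSubmodule ≤ M.toSubmodule :=
  sInf_le ⟨M, h, rfl⟩

lemma diagSum_coeff_shift_zero (f : H2) (d : ℕ) :
    diagSum (coeff (shift 0 f)) (d + 1) = diagSum (coeff f) d := by
  simp [diagSum, Finset.Nat.sum_antidiagonal_succ, coeff_shift_zero, coeff_shift_zero']

lemma diagSum_coeff_shift_one (f : H2) (d : ℕ) :
    diagSum (coeff (shift 1 f)) (d + 1) = diagSum (coeff f) d := by
  simp [diagSum, Finset.Nat.sum_antidiagonal_succ', coeff_shift_one, coeff_shift_one']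

lemma diagMoment_coeff_shift_zero (f : H2) (d : ℕ) :
    diagMoment (coeff (shift 0 f)) (d + 1) = diagMoment (coeff f) d + diagSum (coeff f) d := by
  simp only [diagMoment, diagSum, Finset.Nat.sum_antidiagonal_succ, coeff_shift_zero,
    coeff_shift_zero', ← Finset.sum_add_distrib, mul_zero, zero_add]
  refine Finset.sum_congr rfl fun n _ => ?_
  push_cast; ring

lemma diagMoment_coeff_shift_one (f : H2) (d : ℕ) :
    diagMoment (coeff (shift 1 f)) (d + 1) = diagMoment (coeff f) d - diagSum (coeff f) d := by
  simp only [diagMoment, diagSum, Finset.Nat.sum_antidiagonal_succ', coeff_shift_one,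
    coeff_shift_one', ← Finset.sum_sub_distrib, mul_zero, zero_add]
  refine Finset.sum_congr rfl fun n _ => ?_
  push_cast; ring

/-- The submodule of functions whose homogeneous components all vanish to second order on the
diagonal `z = w`. -/
noncomputable def vanishingSubmodule : HardySubmodule where
  toSubmodule :=
    { carrier := {f | ∀ d, diagSum (coeff f) d = 0 ∧ diagMoment (coeff f) d = 0}
      zero_mem' := fun d => by
        have : coeff (0 : H2) = 0 := funext fun n => by simp [coeff_eq_inner]
        simp [this, diagSum, diagMoment]
      add_mem' := fun {f g} hf hg d => by
        have hf' := hf d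
        have hg' := hg d
        simp only [diagSum, diagMoment] at hf' hg'
        simp [diagSum, diagMoment, coeff_add, mul_add, Finset.sum_add_distrib, hf', hg']
      smul_mem' := fun c f hf d => by
        have hf' := hf d
        simp only [diagSum, diagMoment] at hf'
        simp [diagSum, diagMoment, coeff_smul, mul_left_comm _ c, ← Finset.mul_sum, hf'] }
  isClosed := by
    have hS : ∀ d, Continuous fun f : H2 => diagSum (coeff f) d := fun d =>
      continuous_finsetSum _ fun n _ => continuous_coeff n
    have hD : ∀ d, Continuous fun f : H2 => diagMoment (coeff f) d := fun d =>
      continuous_finsetSum _ fun n _ => (continuous_coeff n).const_mul _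
    change IsClosed {f : H2 | ∀ d, diagSum (coeff f) d = 0 ∧ diagMoment (coeff f) d = 0}
    simp only [Set.ofPred_forall, Set.ofPred_and]
    exact isClosed_iInter fun d => (isClosed_eq (hS d) continuous_const).inter
      (isClosed_eq (hD d) continuous_const)
  shift_mem := by
    intro i f hf d
    have h00 : ∀ i, coeff (shift i f) (0, 0) = 0 := by
      intro i
      fin_cases i
      · exact coeff_shift_zero' f 0
      · exact coeff_shift_one' f 0
    rcases d with _ | d
    · simp [diagSum, diagMoment, h00]
    · obtain ⟨h1, h2⟩ := hf d
      fin_cases i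
      · simp [diagSum_coeff_shift_zero, diagMoment_coeff_shift_zero, h1, h2]
      · simp [diagSum_coeff_shift_one, diagMoment_coeff_shift_one, h1, h2]

lemma diffSqSubmodule_le : diffSqSubmodule.toSubmodule ≤ vanishingSubmodule.toSubmodule := by
  refine HardySubmodule.generatedBy_le fun d => ?_
  rw [ofPolynomial_sq_sub]
  simp only [diagSum, diagMoment, coeff_add, coeff_sub, coeff_smul, coeff_monomial]
  by_cases hd : d = 2
  · subst hd
    have h2 : antidiagonal 2 = {((0 : ℕ), (2 : ℕ)), (1, 1), (2, 0)} := rfl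
    rw [h2]
    norm_num
  · have h0 : ∀ n ∈ antidiagonal d, ((if n = (2, 0) then 1 else 0)
        - 2 * (if n = (1, 1) then 1 else 0) + (if n = (0, 2) then 1 else 0) : ℂ) = 0 := by
      rintro ⟨i, j⟩ hn
      rw [Finset.HasAntidiagonal.mem_antidiagonal] at hn
      rw [if_neg, if_neg, if_neg] <;> simp <;> omega
    refine ⟨Finset.sum_eq_zero h0, Finset.sum_eq_zero fun n hn => ?_⟩
    rw [h0 n hn, mul_zero]

lemma second_difference_monomial_mem (i j : ℕ) :
    monomial (i + 2, j) - (2 : ℂ) • monomial (i + 1, j + 1) + monomial (i, j + 2)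
      ∈ diffSqSubmodule.toSubmodule := by
  have hj : ∀ j : ℕ, monomial (2, j) - (2 : ℂ) • monomial (1, j + 1) + monomial (0, j + 2)
      ∈ diffSqSubmodule.toSubmodule := by
    intro j
    induction j with
    | zero =>
      have := HardySubmodule.mem_generatedBy_self
        (ofPolynomial ((MvPolynomial.X 0 - MvPolynomial.X 1) ^ 2))
      exact ofPolynomial_sq_sub ▸ this
    | succ j ih =>
      have := diffSqSubmodule.shift_mem 1 _ ih
      simpa only [map_add, map_sub, map_smul, shift_one_monomial] using this
  induction i with
  | zero => simpa using hj j
  | succ i ih =>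
    have := diffSqSubmodule.shift_mem 0 _ ih
    simpa only [map_add, map_sub, map_smul, shift_zero_monomial] using this

/-- Along each antidiagonal, the projection onto `[(z - w) ^ 2]` subtracts the affine fit: the
remainder is orthogonal to the second differences of monomials, so it is affine, and it has the
same sum and moment as `f`, because those of the projection vanish. -/
theorem coeff_starProjection (f : H2) (n : ℕ × ℕ) :
    coeff (diffSqSubmodule.toSubmodule.starProjection f) n
      = coeff f n - affineFit (coeff f) n := by
  set g := diffSqSubmodule.toSubmodule.starProjection f with hg
  have hgM : g ∈ vanishingSubmodule.toSubmodule :=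
    diffSqSubmodule_le (Submodule.starProjection_apply_mem _ f)
  have horth : ∀ i j, coeff (f - g) (i + 2, j) - 2 * coeff (f - g) (i + 1, j + 1)
      + coeff (f - g) (i, j + 2) = 0 := by
    intro i j
    have h := (Submodule.mem_orthogonal _ _).1
      (Submodule.sub_starProjection_mem_orthogonal (K := diffSqSubmodule.toSubmodule) f) _
      (second_difference_monomial_mem i j)
    have h2 := inner_smul_left (𝕜 := ℂ) (monomial (i + 1, j + 1)) (f - g) 2
    rw [← hg, inner_add_left, inner_sub_left, h2, inner_monomial, inner_monomial,
      inner_monomial] at h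
    simpa only [map_ofNat] using h
  have hfit := affineFit_eq_self horth n
  have hcongr : affineFit (coeff (f - g)) n = affineFit (coeff f) n := by
    refine affineFit_congr (fun d => ?_) (fun d => ?_) n
    · have := (hgM d).1
      simp only [diagSum] at this ⊢
      simp [coeff_sub, Finset.sum_sub_distrib, this]
    · have := (hgM d).2
      simp only [diagMoment] at this ⊢
      simp [coeff_sub, mul_sub, Finset.sum_sub_distrib, this]
  rw [← hcongr, hfit, coeff_sub]
  ring

/-! ### The homogeneous components of the core operator -/

lemma diagSum_shift_left (a : ℕ × ℕ → ℂ) (m : ℕ) :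
    diagSum (fun n => a (n.1 + 1, n.2)) (m + 1)
      = a (m + 2, 0) + diagSum (fun n => a (n.1 + 1, n.2 + 1)) m := by
  simp [diagSum, Finset.Nat.sum_antidiagonal_succ']

lemma diagSum_shift_right (a : ℕ × ℕ → ℂ) (m : ℕ) :
    diagSum (fun n => a (n.1, n.2 + 1)) (m + 1)
      = a (0, m + 2) + diagSum (fun n => a (n.1 + 1, n.2 + 1)) m := by
  simp [diagSum, Finset.Nat.sum_antidiagonal_succ]

lemma diagMoment_shift_left (a : ℕ × ℕ → ℂ) (m : ℕ) :
    diagMoment (fun n => a (n.1 + 1, n.2)) (m + 1)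
      = (m + 1) * a (m + 2, 0) + diagMoment (fun n => a (n.1 + 1, n.2 + 1)) m
        - diagSum (fun n => a (n.1 + 1, n.2 + 1)) m := by
  simp only [diagMoment, diagSum, Finset.Nat.sum_antidiagonal_succ', add_sub_assoc,
    ← Finset.sum_sub_distrib]
  congr 1
  · push_cast; ring
  · refine Finset.sum_congr rfl fun n _ => ?_
    push_cast; ring

lemma diagMoment_shift_right (a : ℕ × ℕ → ℂ) (m : ℕ) :
    diagMoment (fun n => a (n.1, n.2 + 1)) (m + 1)
      = -((m + 1) * a (0, m + 2)) + (diagMoment (fun n => a (n.1 + 1, n.2 + 1)) m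
        + diagSum (fun n => a (n.1 + 1, n.2 + 1)) m) := by
  simp only [diagMoment, diagSum, Finset.Nat.sum_antidiagonal_succ, ← Finset.sum_add_distrib]
  congr 1
  · push_cast; ring
  · refine Finset.sum_congr rfl fun n _ => ?_
    push_cast; ring

lemma diagSum_add_two (a : ℕ × ℕ → ℂ) (m : ℕ) :
    diagSum a (m + 2)
      = a (0, m + 2) + a (m + 2, 0) + diagSum (fun n => a (n.1 + 1, n.2 + 1)) m := by
  rw [add_assoc, ← diagSum_shift_left]
  simp [diagSum, Finset.Nat.sum_antidiagonal_succ]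

lemma diagMoment_add_two (a : ℕ × ℕ → ℂ) (m : ℕ) :
    diagMoment a (m + 2) = (m + 2) * (a (m + 2, 0) - a (0, m + 2))
      + diagMoment (fun n => a (n.1 + 1, n.2 + 1)) m := by
  rw [diagMoment, ← diagSum, diagSum_add_two]
  simp [diagSum, diagMoment]
  ring

/-- The coefficients of the symmetric eigenvector of the core operator in each degree, scaled so
that the interior entries are `1`. -/
noncomputable def symVec (n : ℕ × ℕ) : ℂ :=
  if n.1 = 0 ∨ n.2 = 0 then -((n.1 + n.2 : ℕ) - 1) / 2 else 1

/-- The coefficients of the antisymmetric eigenvector of the core operator in each degree, scaled so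
that the interior entries are `(i - j) / 2`. In degree `2` all entries are zero. -/
noncomputable def antiVec (n : ℕ × ℕ) : ℂ :=
  if n.1 = 0 then ((n.1 + n.2 : ℕ) - 1) * ((n.1 + n.2 : ℕ) - 2) / 12
  else if n.2 = 0 then -(((n.1 + n.2 : ℕ) - 1) * ((n.1 + n.2 : ℕ) - 2)) / 12
  else ((n.1 : ℂ) - n.2) / 2

/-- The scalar that normalises `symVec` in degree `d`; it is `0` for `d ≤ 1`, by division by
zero. -/
noncomputable def symWeight (d : ℕ) : ℂ := 4 / (d * (d - 1) * (d + 1))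

/-- The scalar that normalises `antiVec` in degree `d`; it is `0` for `d ≤ 2`, by division by
zero. -/
noncomputable def antiWeight (d : ℕ) : ℂ := 144 / (d * (d - 1) * (d + 1) * ((d - 2) * (d + 2)))

/-- The unnormalised pairing of the degree `d` part of `a` with `symVec`. -/
noncomputable def symPair (a : ℕ × ℕ → ℂ) (d : ℕ) : ℂ := diagSum (fun n => symVec n * a n) d

/-- The unnormalised pairing of the degree `d` part of `a` with `antiVec`. -/
noncomputable def antiPair (a : ℕ × ℕ → ℂ) (d : ℕ) : ℂ := diagSum (fun n => antiVec n * a n) d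

lemma symPair_add_two (a : ℕ × ℕ → ℂ) (m : ℕ) :
    symPair a (m + 2) = -(m + 1) / 2 * (a (0, m + 2) + a (m + 2, 0))
      + diagSum (fun n => a (n.1 + 1, n.2 + 1)) m := by
  rw [symPair, diagSum_add_two]
  simp [symVec]
  ring

lemma antiPair_add_two (a : ℕ × ℕ → ℂ) (m : ℕ) :
    antiPair a (m + 2) = (m + 1) * m / 12 * (a (0, m + 2) - a (m + 2, 0))
      + diagMoment (fun n => a (n.1 + 1, n.2 + 1)) m / 2 := by
  rw [antiPair, diagSum_add_two]
  simp only [antiVec, diagSum, diagMoment, Finset.sum_div]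
  congr 1
  · simp
    ring
  · refine Finset.sum_congr rfl fun n _ => ?_
    simp
    ring

section Coefficients

variable (f : H2)

lemma coeff_coreOperator_zero_zero :
    coeff (coreOperator diffSqSubmodule f) (0, 0) = 0 := by
  rw [coreOperator_eq]
  simp [coeff_add, coeff_sub, coeff_shift_zero', coeff_shift_one', coeff_starProjection,
    affineFit, diagSum]

lemma coeff_coreOperator_zero_succ (j : ℕ) :
    coeff (coreOperator diffSqSubmodule f) (0, j + 1)
      = affineFit (fun n => coeff f (n.1, n.2 + 1)) (0, j) - affineFit (coeff f) (0, j + 1) := by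
  rw [coreOperator_eq]
  simp only [add_apply, sub_apply,
    ContinuousLinearMap.comp_apply, coeff_add, coeff_sub, coeff_shift_zero',
    coeff_shift_one _ (0, j), coeff_starProjection]
  simp only [funext (coeff_adjoint_shift_one f)]
  ring

lemma coeff_coreOperator_succ_zero (i : ℕ) :
    coeff (coreOperator diffSqSubmodule f) (i + 1, 0)
      = affineFit (fun n => coeff f (n.1 + 1, n.2)) (i, 0) - affineFit (coeff f) (i + 1, 0) := by
  rw [coreOperator_eq]
  simp only [add_apply, sub_apply,
    ContinuousLinearMap.comp_apply, coeff_add, coeff_sub, coeff_shift_one',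
    coeff_shift_zero _ (i, 0), coeff_starProjection]
  simp only [funext (coeff_adjoint_shift_zero f)]
  ring

lemma coeff_coreOperator_succ_succ (i j : ℕ) :
    coeff (coreOperator diffSqSubmodule f) (i + 1, j + 1)
      = affineFit (fun n => coeff f (n.1 + 1, n.2)) (i, j + 1)
        + affineFit (fun n => coeff f (n.1, n.2 + 1)) (i + 1, j)
        - affineFit (coeff f) (i + 1, j + 1)
        - affineFit (fun n => coeff f (n.1 + 1, n.2 + 1)) (i, j) := by
  rw [coreOperator_eq]
  simp only [add_apply, sub_apply,
    ContinuousLinearMap.comp_apply, coeff_add, coeff_sub, coeff_shift_zero _ (i, j + 1),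
    coeff_shift_one _ (i + 1, j), coeff_shift_one _ (i, j), coeff_starProjection]
  simp only [funext (coeff_adjoint_shift_zero _), funext (coeff_adjoint_shift_one _)]
  ring

/-- In each degree the core operator is the difference of two rank one operators. The entries of the
second difference of the projections are affine in each index away from the ends of the
antidiagonal; the two ends and the interior are compared separately. -/
theorem coeff_coreOperator (n : ℕ × ℕ) :
    coeff (coreOperator diffSqSubmodule f) n
      = symWeight (n.1 + n.2) * symPair (coeff f) (n.1 + n.2) * symVec n
        - antiWeight (n.1 + n.2) * antiPair (coeff f) (n.1 + n.2) * antiVec n := by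
  have c1 : ∀ m : ℕ, ((m + 1 : ℕ) : ℂ) = m + 1 := fun m => by push_cast; ring
  have c2 : ∀ m : ℕ, ((m + 2 : ℕ) : ℂ) = m + 2 := fun m => by push_cast; ring
  have a1 : ∀ m : ℕ, (m : ℂ) + 1 + 1 = m + 2 := fun m => by ring
  have a2 : ∀ m : ℕ, (m : ℂ) + 1 + 2 = m + 3 := fun m => by ring
  have a3 : ∀ m : ℕ, (m : ℂ) + 2 + 1 = m + 3 := fun m => by ring
  have a4 : ∀ m : ℕ, (m : ℂ) + 2 + 2 = m + 4 := fun m => by ring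
  have a5 : ∀ m : ℕ, (m : ℂ) + 2 - 1 = m + 1 := fun m => by ring
  have a6 : ∀ m : ℕ, (m : ℂ) + 2 - 2 = m := fun m => by ring
  have n1 : ∀ m : ℕ, (m : ℂ) + 1 ≠ 0 := fun m => by exact_mod_cast Nat.succ_ne_zero m
  have n2 : ∀ m : ℕ, (m : ℂ) + 2 ≠ 0 := fun m => by exact_mod_cast Nat.succ_ne_zero (m + 1)
  have n3 : ∀ m : ℕ, (m : ℂ) + 3 ≠ 0 := fun m => by exact_mod_cast Nat.succ_ne_zero (m + 2)
  have n4 : ∀ m : ℕ, (m : ℂ) + 4 ≠ 0 := fun m => by exact_mod_cast Nat.succ_ne_zero (m + 3)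
  obtain ⟨_ | i, _ | j⟩ := n
  · simp [coeff_coreOperator_zero_zero, symWeight, antiWeight]
  · rw [coeff_coreOperator_zero_succ]
    rcases j with _ | m
    · simp [affineFit, diagSum, diagMoment, symWeight, antiWeight,
        Finset.Nat.sum_antidiagonal_succ]
      ring
    -- In degree `2` the antisymmetric term vanishes by division by zero, so the general
    -- computation, which cancels `m`, does not apply.
    · rcases Nat.eq_zero_or_pos m with rfl | hm
      · simp [affineFit, symPair, antiPair, diagSum, diagMoment, symVec, antiVec, symWeight,
          antiWeight, Finset.Nat.sum_antidiagonal_succ]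
        ring
      · simp only [zero_add, affineFit, symPair_add_two, antiPair_add_two, diagSum_shift_right,
          diagMoment_shift_right, diagSum_add_two, diagMoment_add_two, symVec, antiVec,
          symWeight, antiWeight, add_assoc m, one_add_one_eq_two, c1, c2, a1, a2, a3, a4, a5, a6,
          Nat.cast_zero, zero_sub, true_or, if_true, Nat.add_eq_zero_iff,
          OfNat.ofNat_ne_zero, and_false, if_false]
        have h0 : (m : ℂ) ≠ 0 := by exact_mod_cast hm.ne'
        have h1 := n1 m
        have h2 := n2 m
        have h3 := n3 m
        have h4 := n4 m
        field_simp
        ring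
  · rw [coeff_coreOperator_succ_zero]
    rcases i with _ | m
    · simp [affineFit, diagSum, diagMoment, symWeight, antiWeight,
        Finset.Nat.sum_antidiagonal_succ]
      ring
    · rcases Nat.eq_zero_or_pos m with rfl | hm
      · simp [affineFit, symPair, antiPair, diagSum, diagMoment, symVec, antiVec, symWeight,
          antiWeight, Finset.Nat.sum_antidiagonal_succ]
        ring
      · simp only [add_zero, affineFit, symPair_add_two, antiPair_add_two, diagSum_shift_left,
          diagMoment_shift_left, diagSum_add_two, diagMoment_add_two, symVec, antiVec,
          symWeight, antiWeight, add_assoc m, one_add_one_eq_two, c1, c2, a1, a2, a3, a4, a5, a6,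
          Nat.cast_zero, sub_zero, or_true, if_true, Nat.add_eq_zero_iff,
          OfNat.ofNat_ne_zero, and_false, if_false]
        have h0 : (m : ℂ) ≠ 0 := by exact_mod_cast hm.ne'
        have h1 := n1 m
        have h2 := n2 m
        have h3 := n3 m
        have h4 := n4 m
        field_simp
        ring
  · rw [coeff_coreOperator_succ_succ]
    rcases Nat.eq_zero_or_pos (i + j) with hm | hm
    · obtain ⟨rfl, rfl⟩ : i = 0 ∧ j = 0 := by omega
      simp [affineFit, symPair, antiPair, diagSum, diagMoment, symVec, antiVec, symWeight,
        antiWeight, Finset.Nat.sum_antidiagonal_succ]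
      ring
    · have e0 : i + (j + 1) = i + j + 1 := by omega
      have e1 : i + 1 + j = i + j + 1 := by omega
      have e2 : i + 1 + (j + 1) = i + j + 2 := by omega
      have hi : (i : ℂ) = (i + j : ℕ) - j := by push_cast; ring
      simp only [affineFit, e0, e1, e2, symPair_add_two, antiPair_add_two, symVec, antiVec,
        Nat.add_eq_zero_iff, one_ne_zero, and_false, or_false, if_false]
      generalize i + j = m at *
      simp only [diagSum_shift_left, diagMoment_shift_left, diagSum_shift_right,
        diagMoment_shift_right, diagSum_add_two, diagMoment_add_two, symWeight, antiWeight,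
        c1, a1, a2, a3, a4, a5, a6, hi]
      have h0 : (m : ℂ) ≠ 0 := by exact_mod_cast hm.ne'
      have h1 := n1 m
      have h2 := n2 m
      have h3 := n3 m
      have h4 := n4 m
      field_simp
      ring

end Coefficients

/-! ### Eigenvalues and eigenvectors -/

lemma symWeight_mul_symPair_symVec (m : ℕ) :
    symWeight (m + 2) * symPair symVec (m + 2) = 2 / (m + 2) := by
  have h1 : (m : ℂ) + 1 ≠ 0 := by exact_mod_cast Nat.succ_ne_zero m
  have h2 : (m : ℂ) + 2 ≠ 0 := by exact_mod_cast Nat.succ_ne_zero (m + 1)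
  have h3 : (m : ℂ) + 3 ≠ 0 := by exact_mod_cast Nat.succ_ne_zero (m + 2)
  have a1 : (m : ℂ) + 2 - 1 = m + 1 := by ring
  have a2 : (m : ℂ) + 2 + 1 = m + 3 := by ring
  rw [symPair_add_two, symWeight]
  simp only [symVec, diagSum, true_or, or_true, if_true, Nat.add_eq_zero_iff, one_ne_zero,
    and_false, or_self, if_false, sum_antidiagonal_one, zero_add, add_zero, Nat.cast_add,
    Nat.cast_ofNat, a1, a2]
  field_simp
  ring

lemma antiWeight_mul_antiPair_antiVec {m : ℕ} (hm : 1 ≤ m) :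
    antiWeight (m + 2) * antiPair antiVec (m + 2) = 2 / (m + 2) := by
  have h0 : (m : ℂ) ≠ 0 := by exact_mod_cast (by omega : m ≠ 0)
  have h1 : (m : ℂ) + 1 ≠ 0 := by exact_mod_cast Nat.succ_ne_zero m
  have h2 : (m : ℂ) + 2 ≠ 0 := by exact_mod_cast Nat.succ_ne_zero (m + 1)
  have h3 : (m : ℂ) + 3 ≠ 0 := by exact_mod_cast Nat.succ_ne_zero (m + 2)
  have h4 : (m : ℂ) + 4 ≠ 0 := by exact_mod_cast Nat.succ_ne_zero (m + 3)
  have a1 : (m : ℂ) + 2 - 1 = m + 1 := by ring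
  have a2 : (m : ℂ) + 2 + 1 = m + 3 := by ring
  have a3 : (m : ℂ) + 2 - 2 = m := by ring
  have a4 : (m : ℂ) + 2 + 2 = m + 4 := by ring
  have key : diagMoment (fun n => antiVec (n.1 + 1, n.2 + 1)) m
      = m * (m + 1) * (m + 2) / 6 := by
    have e : ∀ n : ℕ × ℕ, ((n.1 : ℂ) - n.2) * antiVec (n.1 + 1, n.2 + 1)
        = ((n.1 : ℂ) - n.2) ^ 2 / 2 := fun n => by
      simp [antiVec]; ring
    simp only [diagMoment, e, ← Finset.sum_div, sum_antidiagonal_sub_sq]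
    ring
  rw [antiPair_add_two, key, antiWeight]
  simp only [antiVec, if_true, Nat.add_eq_zero_iff, OfNat.ofNat_ne_zero,
    and_false, if_false, zero_add, add_zero, Nat.cast_add,
    Nat.cast_ofNat, a1, a2, a3, a4]
  field_simp
  ring

lemma symPair_antiVec (m : ℕ) : symPair antiVec (m + 2) = 0 := by
  have key : diagSum (fun n => antiVec (n.1 + 1, n.2 + 1)) m = 0 := by
    have e : ∀ n : ℕ × ℕ, antiVec (n.1 + 1, n.2 + 1) = ((n.1 : ℂ) - n.2) / 2 := fun n => by
      simp [antiVec]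
    simp only [diagSum, e, ← Finset.sum_div, sum_antidiagonal_sub, zero_div]
  rw [symPair_add_two, key]
  simp [antiVec, -mul_eq_zero]
  ring

lemma antiPair_symVec (m : ℕ) : antiPair symVec (m + 2) = 0 := by
  rw [antiPair_add_two, diagMoment]
  simp [symVec, -Finset.sum_sub_distrib, sum_antidiagonal_sub]

lemma symPair_coreOperator (f : H2) (m : ℕ) :
    symPair (coeff (coreOperator diffSqSubmodule f)) (m + 2)
      = 2 / (m + 2) * symPair (coeff f) (m + 2) := by
  have e : ∀ n ∈ antidiagonal (m + 2), symVec n * coeff (coreOperator diffSqSubmodule f) n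
      = symWeight (m + 2) * symPair (coeff f) (m + 2) * (symVec n * symVec n)
        - antiWeight (m + 2) * antiPair (coeff f) (m + 2) * (symVec n * antiVec n) := by
    intro n hn
    rw [coeff_coreOperator, Finset.HasAntidiagonal.mem_antidiagonal.1 hn]
    ring
  have h1 := symWeight_mul_symPair_symVec m
  have h2 := symPair_antiVec m
  rw [symPair, diagSum, Finset.sum_congr rfl e, Finset.sum_sub_distrib, ← Finset.mul_sum,
    ← Finset.mul_sum]
  rw [← h1]
  rw [symPair, diagSum] at h2
  rw [h2, symPair, symPair, diagSum, diagSum]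
  ring

lemma antiPair_coreOperator (f : H2) {m : ℕ} (hm : 1 ≤ m) :
    antiPair (coeff (coreOperator diffSqSubmodule f)) (m + 2)
      = -(2 / (m + 2)) * antiPair (coeff f) (m + 2) := by
  have e : ∀ n ∈ antidiagonal (m + 2), antiVec n * coeff (coreOperator diffSqSubmodule f) n
      = symWeight (m + 2) * symPair (coeff f) (m + 2) * (antiVec n * symVec n)
        - antiWeight (m + 2) * antiPair (coeff f) (m + 2) * (antiVec n * antiVec n) := by
    intro n hn
    rw [coeff_coreOperator, Finset.HasAntidiagonal.mem_antidiagonal.1 hn]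
    ring
  have h1 := antiWeight_mul_antiPair_antiVec hm
  have h2 := antiPair_symVec m
  rw [antiPair, diagSum, Finset.sum_congr rfl e, Finset.sum_sub_distrib, ← Finset.mul_sum,
    ← Finset.mul_sum]
  rw [← h1]
  rw [antiPair, diagSum] at h2
  rw [h2, antiPair, antiPair, diagSum, diagSum]
  ring

/-- The degrees that an eigenvector for a nonzero eigenvalue can charge: in degree `m + 2` the
eigenvalues are `2 / (m + 2)` and, for `m ≥ 1`, also `-2 / (m + 2)`. -/
lemma eigenvalue_of_coeff_ne_zero {f : H2} {μ : ℂ} (hμ : μ ≠ 0)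
    (hf : coreOperator diffSqSubmodule f = μ • f) {n : ℕ × ℕ} (hn : coeff f n ≠ 0) :
    ∃ m, n.1 + n.2 = m + 2 ∧ (μ = 2 / (m + 2) ∨ 1 ≤ m ∧ μ = -(2 / (m + 2))) := by
  have hc := coeff_coreOperator f n
  rw [hf, coeff_smul] at hc
  have hcoeff : coeff (μ • f) = fun k => μ * coeff f k := funext (coeff_smul μ f)
  by_cases hs : symWeight (n.1 + n.2) * symPair (coeff f) (n.1 + n.2) = 0
  · have ha : antiWeight (n.1 + n.2) * antiPair (coeff f) (n.1 + n.2) ≠ 0 := fun ha => by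
      rw [hs, ha] at hc
      exact mul_ne_zero hμ hn (by simpa using hc)
    generalize n.1 + n.2 = d at ha ⊢
    match d with
    | 0 => simp [antiWeight] at ha
    | 1 => simp [antiWeight] at ha
    | 2 => simp [antiWeight] at ha
    | m + 3 =>
      refine ⟨m + 1, rfl, Or.inr ⟨by omega, ?_⟩⟩
      have h := antiPair_coreOperator f (m := m + 1) (by omega)
      rw [hf, hcoeff] at h
      refine mul_right_cancel₀ (right_ne_zero_of_mul ha) (Eq.trans ?_ h)
      simp only [antiPair, diagSum, Finset.mul_sum]
      exact Finset.sum_congr rfl fun k _ => by ring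
  · generalize n.1 + n.2 = d at hs ⊢
    match d with
    | 0 => simp [symWeight] at hs
    | 1 => simp [symWeight] at hs
    | m + 2 =>
      refine ⟨m, rfl, Or.inl ?_⟩
      have h := symPair_coreOperator f m
      rw [hf, hcoeff] at h
      refine mul_right_cancel₀ (right_ne_zero_of_mul hs) (Eq.trans ?_ h)
      simp only [symPair, diagSum, Finset.mul_sum]
      exact Finset.sum_congr rfl fun k _ => by ring

/-- The homogeneous polynomial of degree `d` with coefficients `a`. -/
noncomputable def homogeneous (a : ℕ × ℕ → ℂ) (d : ℕ) : H2 :=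
  ∑ n ∈ antidiagonal d, a n • monomial n

lemma coeff_homogeneous (a : ℕ × ℕ → ℂ) (d : ℕ) (n : ℕ × ℕ) :
    coeff (homogeneous a d) n = if n.1 + n.2 = d then a n else 0 := by
  rw [homogeneous, coeff_sum]
  simp [coeff_smul, coeff_monomial]

lemma symPair_homogeneous (a : ℕ × ℕ → ℂ) (d e : ℕ) :
    symPair (coeff (homogeneous a d)) e = if e = d then symPair a d else 0 := by
  have h : ∀ n ∈ antidiagonal e, symVec n * coeff (homogeneous a d) n
      = if e = d then symVec n * a n else 0 := fun n hn => by
    rw [coeff_homogeneous, Finset.HasAntidiagonal.mem_antidiagonal.1 hn, mul_ite, mul_zero]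
  rw [symPair, diagSum, Finset.sum_congr rfl h]
  split_ifs with hed
  · rw [hed]; rfl
  · simp

lemma antiPair_homogeneous (a : ℕ × ℕ → ℂ) (d e : ℕ) :
    antiPair (coeff (homogeneous a d)) e = if e = d then antiPair a d else 0 := by
  have h : ∀ n ∈ antidiagonal e, antiVec n * coeff (homogeneous a d) n
      = if e = d then antiVec n * a n else 0 := fun n hn => by
    rw [coeff_homogeneous, Finset.HasAntidiagonal.mem_antidiagonal.1 hn, mul_ite, mul_zero]
  rw [antiPair, diagSum, Finset.sum_congr rfl h]
  split_ifs with hed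
  · rw [hed]; rfl
  · simp

lemma coreOperator_homogeneous (a : ℕ × ℕ → ℂ) (d : ℕ) :
    coreOperator diffSqSubmodule (homogeneous a d)
      = (symWeight d * symPair a d) • homogeneous symVec d
        - (antiWeight d * antiPair a d) • homogeneous antiVec d := by
  refine ext_coeff fun n => ?_
  rw [coeff_coreOperator, coeff_sub, coeff_smul, coeff_smul, symPair_homogeneous,
    antiPair_homogeneous, coeff_homogeneous, coeff_homogeneous]
  split_ifs with h
  · rw [h]
  · simp

lemma coreOperator_homogeneous_symVec (m : ℕ) :
    coreOperator diffSqSubmodule (homogeneous symVec (m + 2))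
      = (2 / ((m : ℂ) + 2)) • homogeneous symVec (m + 2) := by
  rw [coreOperator_homogeneous, symWeight_mul_symPair_symVec, antiPair_symVec, mul_zero, zero_smul,
    sub_zero]

lemma coreOperator_homogeneous_antiVec {m : ℕ} (hm : 1 ≤ m) :
    coreOperator diffSqSubmodule (homogeneous antiVec (m + 2))
      = (-(2 / ((m : ℂ) + 2))) • homogeneous antiVec (m + 2) := by
  rw [coreOperator_homogeneous, antiWeight_mul_antiPair_antiVec hm, symPair_antiVec, mul_zero,
    zero_smul, zero_sub, neg_smul]

lemma homogeneous_ne_zero {a : ℕ × ℕ → ℂ} {n : ℕ × ℕ} (h : a n ≠ 0) :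
    homogeneous a (n.1 + n.2) ≠ 0 := by
  intro h0
  have := coeff_homogeneous a (n.1 + n.2) n
  rw [h0, if_pos rfl] at this
  exact h (by rw [← this]; simp [coeff_eq_inner])

lemma homogeneous_symVec_ne_zero (m : ℕ) : homogeneous symVec (m + 2) ≠ 0 := by
  have h := homogeneous_ne_zero (a := symVec) (n := (m + 1, 1)) (by simp [symVec])
  exact h

lemma homogeneous_antiVec_ne_zero {m : ℕ} (hm : 1 ≤ m) : homogeneous antiVec (m + 2) ≠ 0 := by
  have hm' : (m : ℂ) ≠ 0 := by exact_mod_cast (by omega : m ≠ 0)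
  have h := homogeneous_ne_zero (a := antiVec) (n := (m + 1, 1)) (by simp [antiVec, hm'])
  exact h

/-- The core operator of `[(z - w) ^ 2]` as a linear endomorphism. -/
noncomputable abbrev coreEnd : Module.End ℂ H2 := (coreOperator diffSqSubmodule).toLinearMap

lemma hasEigenvalue_coreEnd {f : H2} {μ : ℂ} (hf : f ≠ 0)
    (h : coreOperator diffSqSubmodule f = μ • f) : coreEnd.HasEigenvalue μ :=
  Module.End.hasEigenvalue_of_hasEigenvector ⟨Module.End.mem_eigenspace_iff.2 h, hf⟩

theorem setOf_hasEigenvalue_coreEnd :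
    {μ : ℂ | coreEnd.HasEigenvalue μ} =
      {0, 1} ∪ {μ : ℂ | ∃ n : ℕ, 1 ≤ n ∧
        (μ = 2 / ((n : ℂ) + 2) ∨ μ = -(2 / ((n : ℂ) + 2)))} := by
  ext μ
  constructor
  · intro h
    obtain ⟨f, hf, hf0⟩ := Module.End.HasEigenvalue.exists_hasEigenvector h
    replace hf : coreOperator diffSqSubmodule f = μ • f := Module.End.mem_eigenspace_iff.1 hf
    by_cases hμ : μ = 0
    · exact Or.inl (Or.inl hμ)
    obtain ⟨n, hn⟩ : ∃ n, coeff f n ≠ 0 := by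
      by_contra! h0
      exact hf0 (ext_coeff fun n => by rw [h0 n]; simp [coeff_eq_inner])
    obtain ⟨m, -, hm⟩ := eigenvalue_of_coeff_ne_zero hμ hf hn
    rcases hm with hm | ⟨hm1, hm⟩
    · rcases Nat.eq_zero_or_pos m with rfl | hm0
      · exact Or.inl (Or.inr (by simpa using hm))
      · exact Or.inr ⟨m, hm0, Or.inl hm⟩
    · exact Or.inr ⟨m, hm1, Or.inr hm⟩
  · rintro ((rfl | rfl) | ⟨m, hm, rfl | rfl⟩)
    · refine hasEigenvalue_coreEnd (f := homogeneous 1 0)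
        (homogeneous_ne_zero (n := (0, 0)) (by simp)) ?_
      rw [coreOperator_homogeneous]
      simp [symWeight, antiWeight]
    · refine hasEigenvalue_coreEnd (homogeneous_symVec_ne_zero 0) ?_
      rw [coreOperator_homogeneous_symVec]
      simp
    · exact hasEigenvalue_coreEnd (homogeneous_symVec_ne_zero m)
        (coreOperator_homogeneous_symVec m)
    · exact hasEigenvalue_coreEnd (homogeneous_antiVec_ne_zero hm)
        (coreOperator_homogeneous_antiVec hm)

/-- The eigenvalue `1` occurs in degree `2` only, where its eigenvectors are the multiples of
`(z - w) ^ 2`. -/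
lemma eigenspace_coreEnd_one :
    coreEnd.eigenspace 1 = Submodule.span ℂ {homogeneous symVec 2} := by
  refine le_antisymm (fun f hf => ?_) ?_
  · replace hf : coreOperator diffSqSubmodule f = (1 : ℂ) • f :=
      Module.End.mem_eigenspace_iff.1 hf
    refine Submodule.mem_span_singleton.2 ⟨symWeight 2 * symPair (coeff f) 2, ext_coeff fun n => ?_⟩
    rw [coeff_smul, coeff_homogeneous]
    split_ifs with hn
    · have h := coeff_coreOperator f n
      rw [hf, one_smul, hn] at h
      rw [h]
      simp [antiWeight]
    · by_contra h0
      obtain ⟨m, hm, h | ⟨-, h⟩⟩ :=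
        eigenvalue_of_coeff_ne_zero one_ne_zero hf (n := n) (fun h => h0 (by rw [h, mul_zero]))
      · have h2 : (m : ℂ) + 2 ≠ 0 := by exact_mod_cast Nat.succ_ne_zero (m + 1)
        rw [eq_div_iff h2] at h
        have : m + 2 = 2 := by exact_mod_cast (by simpa using h : (m : ℂ) + 2 = 2)
        omega
      · have h2 : (m : ℂ) + 2 ≠ 0 := by exact_mod_cast Nat.succ_ne_zero (m + 1)
        rw [← neg_div, eq_div_iff h2] at h
        have : m + 2 + 2 = 0 := by
          exact_mod_cast (by linear_combination h : (m : ℂ) + 2 + 2 = 0)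
        omega
  · rw [Submodule.span_singleton_le_iff_mem, Module.End.mem_eigenspace_iff]
    refine (coreOperator_homogeneous_symVec 0).trans ?_
    simp

end HardyBidisk

theorem theorem3p6 :
    let p : MvPolynomial (Fin 2) ℂ := (MvPolynomial.X 0 - MvPolynomial.X 1) ^ 2
    let C : Module.End ℂ HardyBidisk.H2 :=
      (HardyBidisk.coreOperator
        (HardyBidisk.HardySubmodule.generatedBy (HardyBidisk.ofPolynomial p))).toLinearMap
    -- the eigenvalues are exactly `0`, `1` and `± 2 / (n + 2)`, `n ≥ 1`
    ({μ : ℂ | C.HasEigenvalue μ} =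
      {0, 1} ∪ {μ : ℂ | ∃ n : ℕ, 1 ≤ n ∧ (μ = 2 / ((n : ℂ) + 2) ∨ μ = -(2 / ((n : ℂ) + 2)))}) ∧
    -- the largest eigenvalue is `1`, and it is simple
    (IsGreatest {x : ℝ | C.HasEigenvalue (x : ℂ)} 1 ∧
      Module.finrank ℂ (C.eigenspace 1) = 1) ∧
    -- the second largest eigenvalue is `2 / 3`
    IsGreatest {x : ℝ | C.HasEigenvalue (x : ℂ) ∧ x ≠ 1} (2 / 3) := by
  intro p C
  have hset := HardyBidisk.setOf_hasEigenvalue_coreEnd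
  have hmem : ∀ μ : ℂ, C.HasEigenvalue μ ↔ (μ = 0 ∨ μ = 1) ∨ ∃ n : ℕ, 1 ≤ n ∧
      (μ = 2 / ((n : ℂ) + 2) ∨ μ = -(2 / ((n : ℂ) + 2))) := Set.ext_iff.1 hset
  have hle : ∀ x : ℝ, C.HasEigenvalue (x : ℂ) → x = 1 ∨ x ≤ 2 / 3 := by
    intro x hx
    rcases (hmem x).1 hx with (h | h) | ⟨n, hn, h | h⟩
    · right
      rw [Complex.ofReal_eq_zero.1 h]
      norm_num
    · left
      exact_mod_cast h
    · right
      have h' : x = 2 / ((n : ℝ) + 2) :=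
        Complex.ofReal_injective (by rw [h]; push_cast; rfl)
      have hn' : (1 : ℝ) ≤ n := by exact_mod_cast hn
      rw [h']
      gcongr
      linarith
    · right
      have h' : x = -(2 / ((n : ℝ) + 2)) :=
        Complex.ofReal_injective (by rw [h]; push_cast; rfl)
      have : 0 ≤ 2 / ((n : ℝ) + 2) := by positivity
      linarith
  refine ⟨hset, ⟨⟨?_, fun x hx => ?_⟩, ?_⟩, ⟨⟨?_, ?_⟩, fun x hx => ?_⟩⟩
  · exact (hmem _).2 (Or.inl (Or.inr Complex.ofReal_one))
  · rcases hle x hx with h | h <;> linarith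
  · refine (congrArg (fun S : Submodule ℂ HardyBidisk.H2 => Module.finrank ℂ S)
      HardyBidisk.eigenspace_coreEnd_one).trans ?_
    exact finrank_span_singleton (HardyBidisk.homogeneous_symVec_ne_zero 0)
  · refine (hmem _).2 (Or.inr ⟨1, le_rfl, Or.inl ?_⟩)
    push_cast
    norm_num
  · norm_num
  · exact (hle x hx.1).resolve_left hx.2
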